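/- A prefix-free machine is a partial recursive function $C\colon\{0,1\}^*\to\{0,1\}^*$ whose domain of definition is prefix-free (no string in it is a prefix of another string in it). For $s\in\{0,1\}^*$ let $H_C(s)=\min\{|p| : p\in\{0,1\}^*,\ C(p)=s\}$, with $H_C(s)=\infty$ if there is no such $p$. A prefix-free machine $V$ is optimal if for each prefix-free machine $C$ there is $d\in\mathbb{N}$ such that for every $p\in\operatorname{Dom} C$ there is $q\in\operatorname{Dom} V$ with $V(q)=C(p)$ and $|q|\le|p|+d$. Fix an optimal prefix-free machine $U$, write $H=H_U$, and for $n\in\mathbb{N}=\{0,1,2,\dots\}$ let $H(n)$ be $H(s)$ for the string $s$ such that $1s$ is the binary expansion of $n+1$. Theorem. Let $V$ be an optimal prefix-free machine, and for $n\in\mathbb{N}$ let $S_V(n)=\{s\in\{0,1\}^* : |s|=n,\ H_V(s)<n\}$. Then $S_V(n)\subsetneqq\{0,1\}^n$ for every $n\in\mathbb{N}$. Moreover $\#S_V(n)=2^{n-H(n)+O(1)}$ in the following sense: there exists $d\in\mathbb{N}$ such that (i) $\#S_V(n)\le 2^{n-H(n)+d}$ for all $n\in\mathbb{N}$, and (ii)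 $2^{n-H(n)-d}\le\#S_V(n)$ for all sufficiently large $n\in\mathbb{N}$. -/

import Mathlib

namespace AIT

/-- The set of finite binary strings. -/
abbrev BinStr : Type := List Bool

/-- The number denoted by the string `1s` in base two, minus one: this is the position of `s` in
the enumeration of all strings by length and then lexicographically, `λ, 0, 1, 00, 01, …`. -/
def strToNat (s : BinStr) : ℕ :=
  s.foldl (fun (m : ℕ) (b : Bool) => 2 * m + b.toNat) 1 - 1

/-- The `n`-th string in the same enumeration: the binary expansion of `n + 1`, most significant
digit first, with its leading `1` deleted (`Nat.bits` lists the least significant digit first). -/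
def natToStr (n : ℕ) : BinStr :=
  (n + 1).bits.dropLast.reverse

theorem one_le_foldl (s : BinStr) : 1 ≤ s.foldl (fun (m : ℕ) (b : Bool) => 2 * m + b.toNat) 1 := by
  induction s using List.reverseRecOn with
  | nil => simp
  | append_singleton s b ih => simp only [List.foldl_append, List.foldl_cons, List.foldl_nil]; omega

theorem bits_foldl (s : BinStr) :
    (s.foldl (fun (m : ℕ) (b : Bool) => 2 * m + b.toNat) 1).bits = s.reverse ++ [true] := by
  induction s using List.reverseRecOn with
  | nil => simp
  | append_singleton s b ih =>
    have h := one_le_foldl s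
    set k := s.foldl (fun (m : ℕ) (b : Bool) => 2 * m + b.toNat) 1 with hk
    have e : 2 * k + b.toNat = Nat.bit b k := by
      cases b <;> simp [Nat.bit]
    rw [List.foldl_append, List.foldl_cons, List.foldl_nil, ← hk, e]
    rw [Nat.bits_append_bit _ _ (by omega), ih]
    simp

theorem natToStr_strToNat (s : BinStr) : natToStr (strToNat s) = s := by
  have h := one_le_foldl s
  unfold natToStr strToNat
  rw [Nat.sub_add_cancel h, bits_foldl]
  simp

theorem strToNat_natToStr (n : ℕ) : strToNat (natToStr n) = n := by
  suffices h : ∀ m : ℕ, m ≠ 0 →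
      (m.bits.dropLast.reverse).foldl (fun (m : ℕ) (b : Bool) => 2 * m + b.toNat) 1 = m by
    unfold strToNat natToStr
    rw [h _ n.succ_ne_zero]
    rfl
  intro m
  induction m using Nat.binaryRec' with
  | zero => simp
  | bit b k hb ih =>
    intro _
    rcases Nat.eq_zero_or_pos k with rfl | hk
    · cases b
      · simp at hb
      · simp
    · have hne : k.bits ≠ [] := by
        intro h
        have h2 := Nat.size_eq_bits_len k
        rw [h] at h2
        have := Nat.size_pos.2 hk
        simp at h2
        omega
      rw [Nat.bits_append_bit _ _ (by omega), List.dropLast_cons_of_ne_nil hne,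
        List.reverse_cons, List.foldl_append, ih (by omega)]
      cases b <;> simp [Nat.bit]

/-- No string in `A` is a prefix of another string in `A`. -/
def IsPrefixFree (A : Set BinStr) : Prop :=
  ∀ p ∈ A, ∀ q ∈ A, p <+: q → p = q

/-- A prefix-free machine: a partial recursive function on binary strings with prefix-free
domain. -/
def IsPrefixFreeMachine (C : BinStr →. BinStr) : Prop :=
  Partrec C ∧ IsPrefixFree C.Dom

/-- `H_C(s)`, the minimal length of a string `p` with `C(p) = s`; it is `⊤` if there is none. -/
noncomputable def complexity (C : BinStr →. BinStr) (s : BinStr) : ℕ∞ :=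
  ⨅ (p : BinStr) (_ : s ∈ C p), (p.length : ℕ∞)

/-- An optimal prefix-free machine. -/
def IsOptimal (U : BinStr →. BinStr) : Prop :=
  IsPrefixFreeMachine U ∧
    ∀ C : BinStr →. BinStr, IsPrefixFreeMachine C →
      ∃ d : ℕ, ∀ p : BinStr, ∀ s ∈ C p, ∃ q : BinStr, s ∈ U q ∧ q.length ≤ p.length + d

/-- For an optimal machine all complexities are finite. -/
theorem IsOptimal.complexity_ne_top {U : BinStr →. BinStr} (hU : IsOptimal U) (s : BinStr) :
    complexity U s ≠ ⊤ := by
  let C : BinStr →. BinStr := fun p => (List.casesOn p (some s) fun _ _ => none : Option BinStr)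
  have hC : IsPrefixFreeMachine C := by
    refine ⟨?_, ?_⟩
    · have h : Primrec fun p : BinStr =>
          (List.casesOn p (some s) fun _ _ => none : Option BinStr) :=
        Primrec.list_casesOn Primrec.id (Primrec.const _) (Primrec.const none).to₂
      exact h.to_comp.ofOption
    · rintro (_ | ⟨a, p⟩) hp (_ | ⟨b, q⟩) hq _
      · rfl
      · exact absurd hq (by simp [C, PFun.Dom])
      · exact absurd hp (by simp [C, PFun.Dom])
      · exact absurd hq (by simp [C, PFun.Dom])
  obtain ⟨d, hd⟩ := hU.2 C hC
  obtain ⟨q, hq, -⟩ := hd [] s (by simp [C])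
  exact ne_top_of_le_ne_top (ENat.natCast_ne_top q.length) (iInf₂_le q hq)

/-- `H_U(n)` for a natural number `n`, identified with the `n`-th string, as a natural number. For
an optimal `U` the complexity is finite, by `IsOptimal.complexity_ne_top`. -/
noncomputable def natComplexity (U : BinStr →. BinStr) (n : ℕ) : ℕ :=
  (complexity U (natToStr n)).toNat

/-- `{0,1}ⁿ`. -/
def stringsOfLength (n : ℕ) : Set BinStr :=
  {s | s.length = n}

/-- `S_V(n)`, the set of strings `s` of length `n` with `H_V(s) < n`. -/
def compressible (V : BinStr →. BinStr) (n : ℕ) : Set BinStr :=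
  {s | s.length = n ∧ complexity V s < (n : ℕ∞)}

end AIT

/-! Strictness is counting: only `2 ^ n - 1` programs are shorter than `n`, and each has at most one
output.

Lower bound. Let `p` be a shortest `U`-program for `n`. From the string `0^d 1 p q` a machine reads
off `d`, then `p` (the domain of `U` is prefix-free), hence `n`, hence the length that `q` must
have; it outputs `q` padded with zeros to length `n`. If `|p| + |q| + 2d + 1 = n`, this program has
length `n - d`. So once `d` exceeds the simulation constant of `V`, all `2^(n - H(n) - 2d - 1)`
choices of `q` give compressible strings (`exists_compressible_padding`).

Upper bound. Let `N_n` be the number of `V`-programs shorter than `n` whose output has length `n`,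
so `#S_V(n) ≤ N_n`. A program is counted for one `n` only, so Kraft's inequality gives `∑ N_n 2^(-n)
≤ ∑ 2^(-|p|) ≤ 1`. When an enumeration of `V` brings the count for `n` up to `2^j`, request a
description of `n` of length `n - j + 1`. By geometric summation the requests for `n` weigh at most
`N_n 2^(-n)`, so `kraft_chaitin` applies and `H(n) ≤ n - j + O(1)` whenever `2^j ≤ #S_V(n)`. -/

namespace AIT

open Encodable Computable

/-! ### Computable enumerations and machines -/

/-- A partial recursive function has a computable enumeration of its graph in which every argument
occurs at most once. -/
theorem exists_graph_enumeration {V : BinStr →. BinStr} (hV : Partrec V) :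
    ∃ e : ℕ → Option (BinStr × BinStr), Computable e ∧
      (∀ p s, s ∈ V p ↔ ∃ k, e k = some (p, s)) ∧
      ∀ k k' p s s', e k = some (p, s) → e k' = some (p, s') → k = k' := by
  obtain ⟨c, hc⟩ := Nat.Partrec.Code.exists_code.1 hV
  have hmem : ∀ (p : BinStr) (x : ℕ),
      (∃ t, x ∈ Nat.Partrec.Code.evaln t c (encode p)) ↔ ∃ s, s ∈ V p ∧ encode s = x := by
    intro p x
    rw [← Nat.Partrec.Code.evaln_complete, hc]
    simp
  let u : ℕ → BinStr → Option ℕ := fun t p => Nat.Partrec.Code.evaln t c (encode p)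
  have hu0 : ∀ p, u 0 p = none := fun p => by simp [u, Nat.Partrec.Code.evaln]
  have hmono : ∀ p x t t', t ≤ t' → u t p = some x → u t' p = some x := fun p x t t' h hx =>
    Nat.Partrec.Code.evaln_mono h hx
  -- The index `k` codes an argument `p` and a time `t`; the pair is emitted only if `t + 1` is the
  -- first sufficient time bound. As `decode₂` accepts only the canonical code of `p`, no argument
  -- is emitted twice, so programs can later be counted by indices.
  let e : ℕ → Option (BinStr × BinStr) := fun k =>
    (decode₂ BinStr k.unpair.1).bind fun p =>
      if u k.unpair.2 p = none then
        (u (k.unpair.2 + 1) p).bind fun x => (decode x : Option BinStr).map fun s => (p, s)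
      else none
  have he : ∀ k p s, e k = some (p, s) ↔
      k.unpair.1 = encode p ∧ u k.unpair.2 p = none ∧ u (k.unpair.2 + 1) p = some (encode s) := by
    intro k p s
    simp only [e, Option.bind_eq_some_iff]
    constructor
    · rintro ⟨p', hp', h⟩
      split_ifs at h with h0
      simp only [Option.bind_eq_some_iff, Option.map_eq_some_iff, Prod.mk.injEq] at h
      obtain ⟨x, hx, s', hs', rfl, rfl⟩ := h
      refine ⟨(mem_decode₂.1 hp').symm, h0, ?_⟩
      obtain ⟨s'', -, rfl⟩ := (hmem p' x).1 ⟨_, hx⟩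
      rw [encodek] at hs'
      rw [hx, Option.some.inj hs']
    · rintro ⟨h1, h2, h3⟩
      refine ⟨p, mem_decode₂.2 h1.symm, ?_⟩
      simp [h2, h3]
  refine ⟨e, ?_, ?_, ?_⟩
  · have hu : Primrec₂ u := Nat.Partrec.Code.primrec_evaln.comp
      (((Primrec.fst.pair (Primrec.const c))).pair (Primrec.encode.comp Primrec.snd))
    have ht : Primrec fun a : ℕ × BinStr => a.1.unpair.2 :=
      Primrec.snd.comp (Primrec.unpair.comp Primrec.fst)
    have h : Primrec e := by
      refine Primrec.option_bind (Primrec.decode₂.comp (Primrec.fst.comp Primrec.unpair))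
        (Primrec.ite (Primrec.eq.comp (hu.comp ht Primrec.snd) (Primrec.const none)) ?_
          (Primrec.const none))
      refine Primrec.option_bind (hu.comp (Primrec.succ.comp ht) Primrec.snd)
        (Primrec.option_map (Primrec.decode.comp Primrec.snd) ?_)
      exact Primrec.pair (Primrec.snd.comp (Primrec.fst.comp Primrec.fst)) Primrec.snd
    exact h.to_comp
  · intro p s
    have : s ∈ V p ↔ ∃ t, u t p = some (encode s) := by
      refine Iff.trans ?_ (hmem p (encode s)).symm
      simp
    rw [this]
    constructor
    · intro h
      have hpos : Nat.find h ≠ 0 := fun h0 => by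
        have := Nat.find_spec h
        rw [h0, hu0] at this
        cases this
      obtain ⟨t, ht⟩ := Nat.exists_eq_succ_of_ne_zero hpos
      refine ⟨Nat.pair (encode p) t, (he _ _ _).2 ⟨by simp, ?_, ?_⟩⟩
      · rw [Nat.unpair_pair]
        by_contra hne
        obtain ⟨x, hx⟩ := Option.ne_none_iff_exists'.1 hne
        have h1 := hmono p x t (Nat.find h) (by omega) hx
        rw [Nat.find_spec h] at h1
        cases h1
        exact Nat.find_min h (by omega) hx
      · have := Nat.find_spec h
        rw [ht] at this
        simpa using this
    · rintro ⟨k, hk⟩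
      exact ⟨_, ((he _ _ _).1 hk).2.2⟩
  · intro k k' p s s' hk hk'
    obtain ⟨h1, h2, h3⟩ := (he _ _ _).1 hk
    obtain ⟨h1', h2', h3'⟩ := (he _ _ _).1 hk'
    have : k.unpair = k'.unpair := by
      refine Prod.ext (h1.trans h1'.symm) (le_antisymm ?_ ?_)
      · by_contra hlt
        have := hmono p _ _ k.unpair.2 (by omega) h3'
        simp [h2] at this
      · by_contra hlt
        have := hmono p _ _ k'.unpair.2 (by omega) h3
        simp [h2'] at this
    rw [← Nat.pair_unpair k, this, Nat.pair_unpair]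

/-- A computable enumeration of pairs whose first components are pairwise prefix-incomparable
is the graph of a prefix-free machine, which an optimal machine simulates. -/
theorem IsOptimal.simulates_enumeration {U : BinStr →. BinStr} (hU : IsOptimal U) {α : Type*}
    [Primcodable α] {e : α → Option (BinStr × BinStr)} (he : Computable e)
    (hpf : ∀ a a' p p' s s', e a = some (p, s) → e a' = some (p', s') → p <+: p' →
      p = p' ∧ s = s') :
    ∃ d : ℕ, ∀ a p s, e a = some (p, s) → ∃ q, s ∈ U q ∧ q.length ≤ p.length + d := by
  let f : BinStr → ℕ → Option BinStr := fun p k =>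
    ((decode k : Option α).bind e).bind fun x => if x.1 = p then some x.2 else none
  have hf : ∀ p k s, f p k = some s ↔ ∃ a, (decode k : Option α) = some a ∧ e a = some (p, s) := by
    intro p k s
    simp only [f, Option.bind_eq_some_iff]
    constructor
    · rintro ⟨⟨p', s'⟩, ⟨a, ha, h⟩, h'⟩
      split_ifs at h' with hp
      cases h'
      dsimp only at hp
      exact ⟨a, ha, hp ▸ h⟩
    · rintro ⟨a, ha, h⟩
      exact ⟨(p, s), ⟨a, ha, h⟩, by simp⟩
  have hfc : Computable₂ f := by
    refine Computable.option_bind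
      (Computable.option_bind (Computable.decode.comp Computable.snd) (he.comp Computable.snd)) ?_
    refine Primrec.to_comp (f := fun x : (BinStr × ℕ) × (BinStr × BinStr) =>
      if x.2.1 = x.1.1 then some x.2.2 else none) ?_
    exact Primrec.ite (Primrec.eq.comp (Primrec.fst.comp Primrec.snd)
      (Primrec.fst.comp Primrec.fst)) (Primrec.option_some.comp (Primrec.snd.comp Primrec.snd))
      (Primrec.const none)
  let C : BinStr →. BinStr := fun p => Nat.rfindOpt (f p)
  have hC : IsPrefixFreeMachine C := by
    refine ⟨Partrec.rfindOpt hfc, ?_⟩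
    intro p hp q hq hpq
    obtain ⟨k, s, hk⟩ := Nat.rfindOpt_dom.1 hp
    obtain ⟨k', s', hk'⟩ := Nat.rfindOpt_dom.1 hq
    obtain ⟨a, -, ha⟩ := (hf _ _ _).1 hk
    obtain ⟨a', -, ha'⟩ := (hf _ _ _).1 hk'
    exact (hpf _ _ _ _ _ _ ha ha' hpq).1
  obtain ⟨d, hd⟩ := hU.2 C hC
  refine ⟨d, fun a p s ha => hd p s ?_⟩
  have hdom : (C p).Dom := Nat.rfindOpt_dom.2 ⟨encode a, s, (hf _ _ _).2 ⟨a, encodek a, ha⟩⟩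
  obtain ⟨k, hk⟩ := Nat.rfindOpt_spec (Part.get_mem hdom)
  obtain ⟨a', -, ha'⟩ := (hf _ _ _).1 hk
  -- The search may stop at another entry for `p`; `hpf` with `p = p'` forces the same output.
  have := (hpf _ _ _ _ _ _ ha ha' List.prefix_rfl).2
  rw [this]
  exact Part.get_mem hdom

/-! ### Strings as dyadic intervals -/

theorem strToNat_append_singleton (s : BinStr) (b : Bool) :
    strToNat (s ++ [b]) + 1 = 2 * (strToNat s + 1) + b.toNat := by
  have h := one_le_foldl s
  simp only [strToNat, List.foldl_append, List.foldl_cons, List.foldl_nil]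
  omega

/-- If `1p` has binary value `v`, then `1pq` has a value in `[v 2^|q|, (v + 1) 2^|q|)`. This bound
and the next are the two ends of that interval. -/
theorem strToNat_append_ge (p q : BinStr) :
    (strToNat p + 1) * 2 ^ q.length ≤ strToNat (p ++ q) + 1 := by
  induction q using List.reverseRecOn with
  | nil => simp
  | append_singleton q b ih =>
    rw [← List.append_assoc, strToNat_append_singleton, List.length_append, List.length_singleton,
      pow_succ]
    nlinarith

theorem strToNat_append_lt (p q : BinStr) :
    strToNat (p ++ q) + 2 ≤ (strToNat p + 2) * 2 ^ q.length := by
  induction q using List.reverseRecOn with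
  | nil => simp
  | append_singleton q b ih =>
    have h := strToNat_append_singleton (p ++ q) b
    have hb : b.toNat ≤ 1 := Bool.toNat_le b
    rw [← List.append_assoc, List.length_append, List.length_singleton, pow_succ]
    nlinarith

theorem two_pow_length_le (p : BinStr) : 2 ^ p.length ≤ strToNat p + 1 := by
  simpa [strToNat] using strToNat_append_ge [] p

theorem lt_two_pow_length (p : BinStr) : strToNat p + 1 < 2 ^ (p.length + 1) := by
  have h := strToNat_append_lt [] p
  simp only [List.nil_append, strToNat, List.foldl_nil, le_refl, tsub_eq_zero_of_le] at h ⊢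
  rw [pow_succ]
  omega

theorem primrec_strToNat : Primrec strToNat := by
  have hb : Primrec Bool.toNat := Primrec.dom_finite _
  refine Primrec.nat_sub.comp (Primrec.list_foldl
    (h := fun (_ : BinStr) (x : ℕ × Bool) => 2 * x.1 + x.2.toNat) Primrec.id (Primrec.const 1) ?_)
    (Primrec.const 1)
  exact Primrec.nat_add.comp
    (Primrec.nat_mul.comp (Primrec.const 2) (Primrec.fst.comp Primrec.snd))
    (hb.comp (Primrec.snd.comp Primrec.snd))

theorem primrec_two_pow : Primrec fun n : ℕ => 2 ^ n :=
  (Primrec₂.unpaired'.1 Nat.Primrec.pow).comp (Primrec.const 2) Primrec.id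

/-! ### The Kraft–Chaitin theorem -/

/-- The weight `2^{-l}` of a request `(l, s)` for a description of `s` of length `l`. -/
noncomputable def requestWeight (o : Option (ℕ × BinStr)) : ℝ :=
  o.elim 0 fun x => (1 / 2) ^ x.1

theorem requestWeight_nonneg (o : Option (ℕ × BinStr)) : 0 ≤ requestWeight o := by
  cases o <;> simp [requestWeight]

/-- The total weight of the first `k` requests, as a pair `(L, A)` that stands for `A / 2 ^ L`. -/
def requestSum (r : ℕ → Option (ℕ × BinStr)) (k : ℕ) : ℕ × ℕ :=
  Nat.rec (0, 0) (fun i x =>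
    Option.casesOn (r i) x fun y => (x.1 + y.1, x.2 * 2 ^ y.1 + 2 ^ x.1)) k

theorem requestSum_eq (r : ℕ → Option (ℕ × BinStr)) (k : ℕ) :
    ((requestSum r k).2 : ℝ) / 2 ^ (requestSum r k).1 =
      ∑ i ∈ Finset.range k, requestWeight (r i) := by
  induction k with
  | zero => simp [requestSum]
  | succ k ih =>
    rw [Finset.sum_range_succ, ← ih]
    have e : requestSum r (k + 1) = Option.casesOn (r k) (requestSum r k) fun y =>
        ((requestSum r k).1 + y.1,
          (requestSum r k).2 * 2 ^ y.1 + 2 ^ (requestSum r k).1) := rfl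
    rw [e]
    cases r k with
    | none => simp [requestWeight]
    | some y =>
      simp only [requestWeight, Option.elim_some]
      push_cast
      rw [pow_add, one_div, inv_pow]
      field_simp

theorem computable_requestSum {r : ℕ → Option (ℕ × BinStr)} (hr : Computable r) :
    Computable (requestSum r) := by
  refine Computable.nat_rec (h := fun (_ : ℕ) (x : ℕ × (ℕ × ℕ)) => (Option.casesOn (r x.1) x.2
    fun y => (x.2.1 + y.1, x.2.2 * 2 ^ y.1 + 2 ^ x.2.1) : ℕ × ℕ)) Computable.id
    (Computable.const (0, 0)) ?_
  refine Computable.option_casesOn (hr.comp (Computable.fst.comp Computable.snd))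
    (Computable.snd.comp Computable.snd) ?_
  have hx : Primrec fun a : (ℕ × (ℕ × (ℕ × ℕ))) × (ℕ × BinStr) => a.1.2.2 :=
    Primrec.snd.comp (Primrec.snd.comp Primrec.fst)
  have hy : Primrec fun a : (ℕ × (ℕ × (ℕ × ℕ))) × (ℕ × BinStr) => a.2.1 :=
    Primrec.fst.comp Primrec.snd
  refine Primrec.to_comp (f := fun a : (ℕ × (ℕ × (ℕ × ℕ))) × (ℕ × BinStr) =>
    (a.1.2.2.1 + a.2.1, a.1.2.2.2 * 2 ^ a.2.1 + 2 ^ a.1.2.2.1)) ?_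
  exact (Primrec.nat_add.comp (Primrec.fst.comp hx) hy).pair
    (Primrec.nat_add.comp
      (Primrec.nat_mul.comp (Primrec.snd.comp hx) (primrec_two_pow.comp hy))
      (primrec_two_pow.comp (Primrec.fst.comp hx)))

/-- `p` is the codeword for a request of length `l` that is made when the total weight of the
earlier requests is `x.2 / 2 ^ x.1`. -/
def IsCodeword (x : ℕ × ℕ) (l : ℕ) (p : BinStr) : Prop :=
  p.length = l + 1 ∧
    x.2 * 2 ^ (l + 1) + 2 ^ (l + 1) * 2 ^ x.1 ≤ (strToNat p + 1) * 2 ^ x.1 ∧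
    (strToNat p + 1) * 2 ^ x.1 < x.2 * 2 ^ (l + 1) + 2 ^ x.1 + 2 ^ (l + 1) * 2 ^ x.1

instance (x : ℕ × ℕ) (l : ℕ) (p : BinStr) : Decidable (IsCodeword x l p) :=
  inferInstanceAs (Decidable (_ ∧ _ ∧ _))

/-- With `a` the weight already spent, `1p` has value `2^(l+1) + ⌈a 2^(l+1)⌉`. The definition clears
denominators so that the test is primitive recursive. -/
theorem isCodeword_iff (x : ℕ × ℕ) (l : ℕ) (p : BinStr) :
    IsCodeword x l p ↔ p.length = l + 1 ∧
      (x.2 : ℝ) / 2 ^ x.1 * 2 ^ (l + 1) + 2 ^ (l + 1) ≤ strToNat p + 1 ∧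
      (strToNat p + 1 : ℝ) < (x.2 : ℝ) / 2 ^ x.1 * 2 ^ (l + 1) + 1 + 2 ^ (l + 1) := by
  have h2 : (0 : ℝ) < 2 ^ x.1 := by positivity
  refine and_congr_right fun _ => and_congr ?_ ?_
  · rw [← mul_le_mul_iff_left₀ h2, ← Nat.cast_le (α := ℝ)]
    push_cast
    rw [show ((x.2 : ℝ) / 2 ^ x.1 * 2 ^ (l + 1) + 2 ^ (l + 1)) * 2 ^ x.1 =
      x.2 * 2 ^ (l + 1) + 2 ^ (l + 1) * 2 ^ x.1 by field_simp]
  · rw [← mul_lt_mul_iff_left₀ h2, ← Nat.cast_lt (α := ℝ)]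
    push_cast
    rw [show ((x.2 : ℝ) / 2 ^ x.1 * 2 ^ (l + 1) + 1 + 2 ^ (l + 1)) * 2 ^ x.1 =
      x.2 * 2 ^ (l + 1) + 2 ^ x.1 + 2 ^ (l + 1) * 2 ^ x.1 by field_simp]

/-- The slot `[a, a + 2^(-l))` has the width of two cells of size `2^(-(l+1))`. Rounding `a` up to
the grid loses less than one cell, so a whole cell fits; this is why codewords have length `l + 1`.
-/
theorem exists_isCodeword {x : ℕ × ℕ} {l : ℕ} (h : (x.2 : ℝ) / 2 ^ x.1 + (1 / 2) ^ l ≤ 1) :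
    ∃ p, IsCodeword x l p := by
  set a : ℝ := (x.2 : ℝ) / 2 ^ x.1 with ha
  have ha0 : 0 ≤ a := by positivity
  have hpow : (1 / 2 : ℝ) ^ l * 2 ^ (l + 1) = 2 := by
    rw [pow_succ, ← mul_assoc, ← mul_pow]; norm_num
  have hx0 : 0 ≤ a * 2 ^ (l + 1) := by positivity
  have hle := Nat.le_ceil (a * 2 ^ (l + 1))
  have hlt := Nat.ceil_lt_add_one hx0
  set m := ⌈a * 2 ^ (l + 1)⌉₊ with hm
  have hub : a * 2 ^ (l + 1) + 2 ≤ 2 ^ (l + 1) := by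
    have := mul_le_mul_of_nonneg_right h (show (0 : ℝ) ≤ 2 ^ (l + 1) by positivity)
    rw [add_mul, hpow] at this
    linarith
  have hm' : m < 2 ^ (l + 1) := by
    have : (m : ℝ) < (2 ^ (l + 1) : ℕ) := by push_cast; linarith
    exact_mod_cast this
  have hpos : 0 < 2 ^ (l + 1) := by positivity
  have hv : strToNat (natToStr (2 ^ (l + 1) + m - 1)) + 1 = 2 ^ (l + 1) + m := by
    rw [strToNat_natToStr]; omega
  refine ⟨natToStr (2 ^ (l + 1) + m - 1), (isCodeword_iff _ _ _).2 ⟨?_, ?_⟩⟩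
  · have h1 := two_pow_length_le (natToStr (2 ^ (l + 1) + m - 1))
    have h2 := lt_two_pow_length (natToStr (2 ^ (l + 1) + m - 1))
    rw [hv] at h1 h2
    have h3 : 2 ^ (natToStr (2 ^ (l + 1) + m - 1)).length < 2 ^ (l + 2) := by
      rw [pow_succ 2 (l + 1)]; omega
    have h4 : 2 ^ (l + 1) < 2 ^ ((natToStr (2 ^ (l + 1) + m - 1)).length + 1) := by omega
    rw [Nat.pow_lt_pow_iff_right (by norm_num)] at h3 h4
    omega
  · have hv' : (strToNat (natToStr (2 ^ (l + 1) + m - 1)) + 1 : ℝ) = 2 ^ (l + 1) + m := by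
      exact_mod_cast hv
    rw [hv']
    constructor <;> linarith

theorem primrec_isCodeword : PrimrecPred fun a : (ℕ × ℕ) × (ℕ × BinStr) =>
    IsCodeword a.1 a.2.1 a.2.2 := by
  have hL : Primrec fun a : (ℕ × ℕ) × (ℕ × BinStr) => a.1.1 := Primrec.fst.comp Primrec.fst
  have hA : Primrec fun a : (ℕ × ℕ) × (ℕ × BinStr) => a.1.2 := Primrec.snd.comp Primrec.fst
  have hl : Primrec fun a : (ℕ × ℕ) × (ℕ × BinStr) => a.2.1 + 1 :=
    Primrec.succ.comp (Primrec.fst.comp Primrec.snd)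
  have hp : Primrec fun a : (ℕ × ℕ) × (ℕ × BinStr) => a.2.2 := Primrec.snd.comp Primrec.snd
  have h2L := primrec_two_pow.comp hL
  have h2l := primrec_two_pow.comp hl
  have hv := Primrec.nat_mul.comp (Primrec.succ.comp (primrec_strToNat.comp hp)) h2L
  have hAl := Primrec.nat_mul.comp hA h2l
  have hlL := Primrec.nat_mul.comp h2l h2L
  exact (Primrec.eq.comp (Primrec.list_length.comp hp) hl).and
    ((Primrec.nat_le.comp (Primrec.nat_add.comp hAl hlL) hv).and
      (Primrec.nat_lt.comp hv (Primrec.nat_add.comp (Primrec.nat_add.comp hAl h2L) hlL)))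

/-- The pair `(p, s)` if `p` is a codeword for the request `(l, s)`. -/
def assignCodeword (b : ((ℕ × ℕ) × (ℕ × BinStr)) × BinStr) : Option (BinStr × BinStr) :=
  if IsCodeword b.1.1 b.1.2.1 b.1.2.2 then some (b.1.2.2, b.2) else none

theorem primrec_assignCodeword : Primrec assignCodeword :=
  Primrec.ite (primrec_isCodeword.comp Primrec.fst)
    (Primrec.option_some.comp ((Primrec.snd.comp (Primrec.snd.comp Primrec.fst)).pair
      Primrec.snd)) (Primrec.const none)

/-- The half-open dyadic interval of a string contains those of its extensions. -/
theorem dyadic_of_prefix {p p' : BinStr} (h : p <+: p') :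
    (strToNat p + 1 : ℝ) / 2 ^ p.length ≤ (strToNat p' + 1) / 2 ^ p'.length ∧
      (strToNat p' + 2 : ℝ) / 2 ^ p'.length ≤ (strToNat p + 2) / 2 ^ p.length := by
  obtain ⟨q, rfl⟩ := h
  have h1 : ((strToNat p + 1) * 2 ^ q.length : ℝ) ≤ strToNat (p ++ q) + 1 := by
    exact_mod_cast strToNat_append_ge p q
  have h2 : (strToNat (p ++ q) + 2 : ℝ) ≤ (strToNat p + 2) * 2 ^ q.length := by
    exact_mod_cast strToNat_append_lt p q
  rw [List.length_append, pow_add]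
  constructor
  · rw [div_le_div_iff₀ (by positivity) (by positivity)]
    nlinarith [show (0 : ℝ) < 2 ^ p.length by positivity]
  · rw [div_le_div_iff₀ (by positivity) (by positivity)]
    nlinarith [show (0 : ℝ) < 2 ^ p.length by positivity]

/-- The dyadic interval of `p` lies in the slot between the total weights before and after request
`k`. Subtracting `1` removes the leading digit of `1p`. -/
theorem isCodeword_bounds {r : ℕ → Option (ℕ × BinStr)} {k l : ℕ} {s p : BinStr}
    (hk : r k = some (l, s)) (hp : IsCodeword (requestSum r k) l p) :
    ∑ i ∈ Finset.range k, requestWeight (r i) ≤ (strToNat p + 1) / 2 ^ p.length - 1 ∧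
      (strToNat p + 2) / 2 ^ p.length - 1 <
        ∑ i ∈ Finset.range (k + 1), requestWeight (r i) := by
  rw [isCodeword_iff, requestSum_eq] at hp
  obtain ⟨hlen, h1, h2⟩ := hp
  rw [Finset.sum_range_succ, hk, hlen]
  have hw : requestWeight (some (l, s)) = 2 / 2 ^ (l + 1) := by
    simp only [requestWeight, Option.elim_some, one_div, inv_pow]
    rw [pow_succ]; field_simp
  have h2l : (0 : ℝ) < 2 ^ (l + 1) := by positivity
  rw [hw]
  constructor
  · rw [le_sub_iff_add_le, le_div_iff₀ h2l]
    linarith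
  · rw [sub_lt_iff_lt_add, div_lt_iff₀ h2l, add_mul, add_mul, div_mul_cancel₀ _ h2l.ne']
    linarith

theorem IsOptimal.kraft_chaitin_nat {U : BinStr →. BinStr} (hU : IsOptimal U)
    {r : ℕ → Option (ℕ × BinStr)} (hr : Computable r)
    (hsum : ∀ k, ∑ i ∈ Finset.range k, requestWeight (r i) ≤ 1) :
    ∃ d : ℕ, ∀ k l s, r k = some (l, s) → ∃ q, s ∈ U q ∧ q.length ≤ l + d := by
  -- Codewords are not computed: all candidate pairs `(k, p)` are enumerated and tested.
  let e : ℕ × BinStr → Option (BinStr × BinStr) := fun a =>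
    (r a.1).bind fun y => assignCodeword ((requestSum r a.1, (y.1, a.2)), y.2)
  have he : ∀ a p s, e a = some (p, s) ↔
      a.2 = p ∧ ∃ l, r a.1 = some (l, s) ∧ IsCodeword (requestSum r a.1) l p := by
    rintro ⟨k, p'⟩ p s
    simp only [e, assignCodeword, Option.bind_eq_some_iff, Prod.exists]
    constructor
    · rintro ⟨l, s', h1, h2⟩
      split_ifs at h2 with hc
      cases h2
      exact ⟨rfl, l, h1, hc⟩
    · rintro ⟨rfl, l, h1, h2⟩
      exact ⟨l, s, h1, by simp [h2]⟩
  have hec : Computable e := by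
    refine Computable.option_bind (hr.comp Computable.fst) ?_
    have hk : Computable fun a : (ℕ × BinStr) × (ℕ × BinStr) => a.1.1 :=
      Computable.fst.comp Computable.fst
    have harg : Computable fun a : (ℕ × BinStr) × (ℕ × BinStr) =>
        ((requestSum r a.1.1, (a.2.1, a.1.2)), a.2.2) :=
      (((computable_requestSum hr).comp hk).pair
        ((Computable.fst.comp Computable.snd).pair (Computable.snd.comp Computable.fst))).pair
          (Computable.snd.comp Computable.snd)
    exact primrec_assignCodeword.to_comp.comp harg
  obtain ⟨d, hd⟩ := hU.simulates_enumeration hec (by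
    rintro ⟨k, p₁⟩ ⟨k', p₁'⟩ p p' s s' h h' hpp
    obtain ⟨-, l, hk, hp⟩ := (he _ _ _).1 h
    obtain ⟨-, l', hk', hp'⟩ := (he _ _ _).1 h'
    dsimp only at hk hp hk' hp'
    obtain ⟨b1, b2⟩ := isCodeword_bounds hk hp
    obtain ⟨b1', b2'⟩ := isCodeword_bounds hk' hp'
    obtain ⟨i1, i2⟩ := dyadic_of_prefix hpp
    have hmono : ∀ i j : ℕ, i ≤ j → ∑ t ∈ Finset.range i, requestWeight (r t) ≤
        ∑ t ∈ Finset.range j, requestWeight (r t) := fun i j hij =>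
      Finset.sum_le_sum_of_subset_of_nonneg (Finset.range_mono hij)
        fun _ _ _ => requestWeight_nonneg _
    have hstep : ∀ p : BinStr, (strToNat p + 1 : ℝ) / 2 ^ p.length <
        (strToNat p + 2) / 2 ^ p.length := fun p => by gcongr; norm_num
    have hs := hstep p
    have hs' := hstep p'
    -- Distinct requests own disjoint slots, whereas prefix-comparable codewords have nested
    -- intervals.
    rcases lt_trichotomy k k' with hlt | rfl | hlt
    · linarith [hmono (k + 1) k' hlt]
    · rw [hk] at hk'
      cases hk'
      exact ⟨hpp.eq_of_length (hp.1.trans hp'.1.symm), rfl⟩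
    · linarith [hmono (k' + 1) k hlt])
  refine ⟨d + 1, fun k l s hk => ?_⟩
  obtain ⟨p, hp⟩ : ∃ p, IsCodeword (requestSum r k) l p := by
    apply exists_isCodeword
    have := hsum (k + 1)
    rwa [Finset.sum_range_succ, ← requestSum_eq, hk] at this
  obtain ⟨q, hq, hlen⟩ := hd (k, p) p s ((he _ _ _).2 ⟨rfl, l, hk, hp⟩)
  exact ⟨q, hq, by rw [hp.1] at hlen; omega⟩

/-- **Kraft–Chaitin theorem**: computably many requests `(l, s)` of total weight at most one are
satisfied by an optimal machine up to an additive constant. -/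
theorem IsOptimal.kraft_chaitin {U : BinStr →. BinStr} (hU : IsOptimal U) {α : Type*}
    [Primcodable α] {r : α → Option (ℕ × BinStr)} (hr : Computable r)
    (hsum : ∀ F : Finset α, ∑ a ∈ F, requestWeight (r a) ≤ 1) :
    ∃ d : ℕ, ∀ a l s, r a = some (l, s) → ∃ q, s ∈ U q ∧ q.length ≤ l + d := by
  let r' : ℕ → Option (ℕ × BinStr) := fun k => (decode₂ α k).bind r
  have hr' : Computable r' :=
    Computable.option_bind Primrec.decode₂.to_comp (hr.comp Computable.snd)
  obtain ⟨d, hd⟩ := hU.kraft_chaitin_nat hr' (by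
    intro k
    -- Using `decode₂`, each request occurs at just one index, so reindexing by ℕ does not inflate
    -- the weight.
    have h := Finset.sum_preimage (encode : α → ℕ) (Finset.range k)
      encode_injective.injOn (fun i => requestWeight (r' i)) (by
        intro i _ hi
        have : decode₂ α i = none := by
          by_contra hne
          obtain ⟨a, ha⟩ := Option.ne_none_iff_exists'.1 hne
          exact hi ⟨a, mem_decode₂.1 ha⟩
        simp [r', this, requestWeight])
    rw [← h]
    simpa [r', encodek₂] using hsum ((Finset.range k).preimage encode encode_injective.injOn))
  exact ⟨d, fun a l s ha => hd (encode a) l s (by simp [r', ha])⟩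

/-! ### Kraft's inequality -/

/-- **Kraft inequality** for a finite prefix-free set. -/
theorem IsPrefixFree.kraft {F : Finset BinStr} (hF : IsPrefixFree (F : Set BinStr)) :
    ∑ p ∈ F, (1 / 2 : ℝ) ^ p.length ≤ 1 := by
  -- The set `{[]}` is prefix-free but not uniquely decodable, so it is treated apart from
  -- Kraft–McMillan.
  by_cases hnil : [] ∈ F
  · have : F = {[]} := Finset.eq_singleton_iff_unique_mem.2
      ⟨hnil, fun p hp => (hF [] hnil p hp List.nil_prefix).symm⟩
    simp [this]
  · have hud : InformationTheory.UniquelyDecodable (F : Set BinStr) := by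
      intro L₁
      induction L₁ with
      | nil =>
        rintro (_ | ⟨w, L₂⟩) - h₂ h
        · rfl
        · rw [List.flatten_nil, List.flatten_cons, eq_comm, List.append_eq_nil_iff] at h
          exact absurd (h.1 ▸ h₂ w List.mem_cons_self) hnil
      | cons v L₁ ih =>
        rintro (_ | ⟨w, L₂⟩) h₁ h₂ h
        · rw [List.flatten_nil, List.flatten_cons, List.append_eq_nil_iff] at h
          exact absurd (h.1 ▸ h₁ v List.mem_cons_self) hnil
        · have hv := h₁ v List.mem_cons_self
          have hw := h₂ w List.mem_cons_self
          rw [List.flatten_cons, List.flatten_cons] at h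
          have hvw : v = w := by
            rcases List.prefix_or_prefix_of_prefix (List.prefix_append v L₁.flatten)
              (h ▸ List.prefix_append w L₂.flatten) with h' | h'
            · exact hF v hv w hw h'
            · exact (hF w hw v hv h').symm
          subst hvw
          rw [ih L₂ (fun x hx => h₁ x (List.mem_cons_of_mem _ hx))
            (fun x hx => h₂ x (List.mem_cons_of_mem _ hx)) (List.append_cancel_left h)]
    simpa using InformationTheory.kraft_mcmillan_inequality hud

/-! ### Complexity and the count of short programs -/

theorem complexity_lt_iff {V : BinStr →. BinStr} {s : BinStr} {n : ℕ} :
    complexity V s < (n : ℕ∞) ↔ ∃ p, s ∈ V p ∧ p.length < n := by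
  simp [complexity, iInf_lt_iff]

theorem natComplexity_le {U : BinStr →. BinStr} {n : ℕ} {p : BinStr} (h : natToStr n ∈ U p) :
    natComplexity U n ≤ p.length :=
  ENat.toNat_le_of_le_natCast (iInf₂_le p h)

theorem IsOptimal.exists_length_eq_natComplexity {U : BinStr →. BinStr} (hU : IsOptimal U)
    (n : ℕ) : ∃ p, natToStr n ∈ U p ∧ p.length = natComplexity U n := by
  have h : complexity U (natToStr n) < ((natComplexity U n + 1 : ℕ) : ℕ∞) := by
    rw [← ENat.natCast_toNat (hU.complexity_ne_top (natToStr n))]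
    exact_mod_cast Nat.lt_succ_self _
  obtain ⟨p, hp, hlt⟩ := complexity_lt_iff.1 h
  exact ⟨p, hp, le_antisymm (Nat.lt_succ_iff.1 hlt) (natComplexity_le hp)⟩

theorem ncard_stringsOfLength (n : ℕ) : (stringsOfLength n).ncard = 2 ^ n := by
  have : (stringsOfLength n).ncard = Nat.card (List.Vector Bool n) := rfl
  rw [this, Nat.card_eq_fintype_card, card_vector, Fintype.card_bool]

theorem finite_stringsOfLength (n : ℕ) : (stringsOfLength n).Finite :=
  Set.finite_of_ncard_pos (by rw [ncard_stringsOfLength]; positivity)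

theorem compressible_subset (V : BinStr →. BinStr) (n : ℕ) :
    compressible V n ⊆ stringsOfLength n := fun _ h => h.1

theorem finite_compressible (V : BinStr →. BinStr) (n : ℕ) : (compressible V n).Finite :=
  (finite_stringsOfLength n).subset (compressible_subset V n)

theorem mem_compressible {V : BinStr →. BinStr} {n : ℕ} {s : BinStr} :
    s ∈ compressible V n ↔ s.length = n ∧ ∃ p, s ∈ V p ∧ p.length < n :=
  and_congr_right fun _ => complexity_lt_iff

theorem compressible_ssubset (V : BinStr →. BinStr) (n : ℕ) :
    compressible V n ⊂ stringsOfLength n := by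
  refine (compressible_subset V n).ssubset_of_ne fun heq => ?_
  have h : ∀ s, ∃ p, s ∈ compressible V n → s ∈ V p ∧ p.length < n := fun s => by
    by_cases hs : s ∈ compressible V n
    · obtain ⟨p, hp⟩ := (mem_compressible.1 hs).2
      exact ⟨p, fun _ => hp⟩
    · exact ⟨[], fun h => absurd h hs⟩
  choose f hf using h
  -- `strToNat` maps the strings shorter than `n` into the numbers below `2 ^ n - 1`.
  have hle : (compressible V n).ncard ≤ (Set.Iio (2 ^ n - 1)).ncard := by
    refine Set.ncard_le_ncard_of_injOn (fun s => strToNat (f s)) ?_ ?_ (Set.finite_Iio _)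
    · intro s hs
      have h1 := lt_two_pow_length (f s)
      have h2 : 2 ^ ((f s).length + 1) ≤ 2 ^ n :=
        Nat.pow_le_pow_right (by norm_num) (hf s hs).2
      simp only [Set.mem_Iio]
      omega
    · intro s hs s' hs' hss
      have : f s = f s' := by
        rw [← natToStr_strToNat (f s), ← natToStr_strToNat (f s')]
        exact congrArg natToStr hss
      have h1 := (hf s hs).1
      rw [this] at h1
      exact Part.mem_unique h1 (hf s' hs').1
  rw [heq, ncard_stringsOfLength, Set.ncard_Iio_nat] at hle
  have : 0 < 2 ^ n := by positivity
  omega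

/-! ### The lower bound -/

theorem primrec_replicate_false : Primrec fun n : ℕ => List.replicate n false := by
  refine (Primrec.list_map (f := List.range) (g := fun _ _ => false) Primrec.list_range
    (Primrec.const false).to₂).of_eq fun n => ?_
  simp

/-- For a description `p` of the `n`-th string, a number `d` and a string `q` such that
`p.length + q.length + 2 * d + 1 = n`, a self-delimiting program for the string of length `n`
that is `q` padded with zeros. -/
def padPair (b : (BinStr × BinStr) × (BinStr × ℕ)) : Option (BinStr × BinStr) :=
  if b.1.1.length + b.2.1.length + 2 * b.2.2 + 1 = strToNat b.1.2 then
    some (List.replicate b.2.2 false ++ true :: (b.1.1 ++ b.2.1),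
      b.2.1 ++ List.replicate (b.1.1.length + 2 * b.2.2 + 1) false)
  else none

theorem primrec_padPair : Primrec padPair := by
  have hp : Primrec fun b : (BinStr × BinStr) × (BinStr × ℕ) => b.1.1 :=
    Primrec.fst.comp Primrec.fst
  have hs : Primrec fun b : (BinStr × BinStr) × (BinStr × ℕ) => b.1.2 :=
    Primrec.snd.comp Primrec.fst
  have hq : Primrec fun b : (BinStr × BinStr) × (BinStr × ℕ) => b.2.1 :=
    Primrec.fst.comp Primrec.snd
  have hd : Primrec fun b : (BinStr × BinStr) × (BinStr × ℕ) => b.2.2 :=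
    Primrec.snd.comp Primrec.snd
  have hpl := Primrec.list_length.comp hp
  have hql := Primrec.list_length.comp hq
  have h2d := Primrec.nat_mul.comp (Primrec.const 2) hd
  refine Primrec.ite (Primrec.eq.comp
    (Primrec.succ.comp (Primrec.nat_add.comp (Primrec.nat_add.comp hpl hql) h2d))
    (primrec_strToNat.comp hs)) (Primrec.option_some.comp (Primrec.pair ?_ ?_))
    (Primrec.const none)
  · exact Primrec.list_append.comp (primrec_replicate_false.comp hd)
      (Primrec.list_cons.comp (Primrec.const true) (Primrec.list_append.comp hp hq))
  · exact Primrec.list_append.comp hq (primrec_replicate_false.comp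
      (Primrec.succ.comp (Primrec.nat_add.comp hpl h2d)))

/-- The first `true` marks the end of the unary header, so the header is self-delimiting. -/
theorem replicate_false_append_prefix {d d' : ℕ} {x x' : BinStr}
    (h : List.replicate d false ++ true :: x <+: List.replicate d' false ++ true :: x') :
    d = d' ∧ x <+: x' := by
  induction d generalizing d' with
  | zero =>
    cases d' with
    | zero => simpa using h
    | succ d' => simp [List.replicate_succ] at h
  | succ d ih =>
    cases d' with
    | zero => simp [List.replicate_succ] at h
    | succ d' =>
      simp only [List.replicate_succ, List.cons_append, List.cons_prefix_cons, true_and] at h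
      obtain ⟨rfl, h2⟩ := ih h
      exact ⟨rfl, h2⟩

theorem exists_compressible_padding {U V : BinStr →. BinStr} (hU : IsPrefixFreeMachine U)
    (hV : IsOptimal V) : ∃ c : ℕ, ∀ n d p q, natToStr n ∈ U p →
      p.length + List.length q + 2 * d + 1 = n →
      ∃ v, q ++ List.replicate (p.length + 2 * d + 1) false ∈ V v ∧ v.length + d ≤ n + c := by
  obtain ⟨e, hec, he, -⟩ := exists_graph_enumeration hU.1
  let g : ℕ × (BinStr × ℕ) → Option (BinStr × BinStr) := fun a =>
    (e a.1).bind fun y => padPair (y, a.2)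
  have hgc : Computable g := by
    refine Computable.option_bind (hec.comp Computable.fst) ?_
    have : Computable fun b : (ℕ × (BinStr × ℕ)) × (BinStr × BinStr) => (b.2, b.1.2) :=
      Computable.snd.pair (Computable.snd.comp Computable.fst)
    exact primrec_padPair.to_comp.comp this
  have hg : ∀ k q d x y, g (k, q, d) = some (x, y) ↔ ∃ p s, e k = some (p, s) ∧
      p.length + q.length + 2 * d + 1 = strToNat s ∧
      x = List.replicate d false ++ true :: (p ++ q) ∧
      y = q ++ List.replicate (p.length + 2 * d + 1) false := by
    intro k q d x y
    simp only [g, padPair, Option.bind_eq_some_iff, Prod.exists]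
    refine exists_congr fun p => exists_congr fun s => and_congr_right fun _ => ?_
    constructor
    · intro h
      split_ifs at h with hc
      cases h
      exact ⟨hc, rfl, rfl⟩
    · rintro ⟨hc, rfl, rfl⟩
      rw [if_pos hc]
  obtain ⟨c, hc⟩ := hV.simulates_enumeration hgc (by
    rintro ⟨k, q, d⟩ ⟨k', q', d'⟩ x x' y y' h h' hxx
    obtain ⟨p, s, hk, hlen, rfl, rfl⟩ := (hg _ _ _ _ _).1 h
    obtain ⟨p', s', hk', hlen', rfl, rfl⟩ := (hg _ _ _ _ _).1 h'
    obtain ⟨rfl, hpq⟩ := replicate_false_append_prefix hxx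
    have hs : s ∈ U p := (he p s).2 ⟨k, hk⟩
    have hs' : s' ∈ U p' := (he p' s').2 ⟨k', hk'⟩
    have hdom : p ∈ U.Dom := Part.dom_iff_mem.2 ⟨s, hs⟩
    have hdom' : p' ∈ U.Dom := Part.dom_iff_mem.2 ⟨s', hs'⟩
    have hpp : p = p' := by
      rcases List.prefix_or_prefix_of_prefix ((List.prefix_append p q).trans hpq)
        (List.prefix_append p' q') with h | h
      · exact hU.2 p hdom p' hdom' h
      · exact (hU.2 p' hdom' p hdom h).symm
    subst hpp
    obtain rfl := Part.mem_unique hs hs'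
    -- Equal `p` and equal header give the same `n`, and the length equation then fixes `|q|`.
    have hqq : q = q' :=
      ((List.prefix_append_right_inj p).1 hpq).eq_of_length (by omega)
    subst hqq
    exact ⟨rfl, rfl⟩)
  refine ⟨c, fun n d p q hp hlen => ?_⟩
  obtain ⟨k, hk⟩ := (he _ _).1 hp
  obtain ⟨v, hv, hvl⟩ := hc (k, q, d) _ _
    ((hg _ _ _ _ _).2 ⟨p, _, hk, by rw [strToNat_natToStr, hlen], rfl, rfl⟩)
  refine ⟨v, hv, ?_⟩
  simp only [List.length_append, List.length_replicate, List.length_cons] at hvl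
  omega

theorem exists_two_pow_le_ncard_compressible {U V : BinStr →. BinStr} (hU : IsOptimal U)
    (hV : IsOptimal V) : ∃ d : ℕ, ∀ n, natComplexity U n + d ≤ n →
      2 ^ (n - natComplexity U n - d) ≤ (compressible V n).ncard := by
  obtain ⟨c, hc⟩ := exists_compressible_padding hU.1 hV
  -- Padding with `d = c + 1` saves `c + 1` bits, one more than simulation by `V` costs; the header
  -- and this saving use up `2 * d + 1` bits of `n`.
  refine ⟨2 * (c + 1) + 1, fun n hn => ?_⟩
  obtain ⟨p, hp, hpl⟩ := hU.exists_length_eq_natComplexity n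
  rw [← ncard_stringsOfLength]
  refine Set.ncard_le_ncard_of_injOn
    (fun q => q ++ List.replicate (p.length + 2 * (c + 1) + 1) false) ?_ ?_
    (finite_compressible V n)
  · intro q hq
    have hq' : q.length = n - natComplexity U n - (2 * (c + 1) + 1) := hq
    obtain ⟨v, hv, hvl⟩ := hc n (c + 1) p q hp (by omega)
    refine mem_compressible.2 ⟨?_, v, hv, by omega⟩
    simp only [List.length_append, List.length_replicate]
    omega
  · intro q _ q' _ h
    exact List.append_cancel_right h

/-- The code `0^|s| 1 s` is prefix-free. -/
theorem IsOptimal.natComplexity_le_two_mul_length {U : BinStr →. BinStr} (hU : IsOptimal U) :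
    ∃ c : ℕ, ∀ n, natComplexity U n ≤ 2 * (natToStr n).length + c := by
  let e : BinStr → Option (BinStr × BinStr) := fun s =>
    some (List.replicate s.length false ++ true :: s, s)
  have hec : Primrec e := Primrec.option_some.comp ((Primrec.list_append.comp
    (primrec_replicate_false.comp Primrec.list_length)
    (Primrec.list_cons.comp (Primrec.const true) Primrec.id)).pair Primrec.id)
  obtain ⟨c, hc⟩ := hU.simulates_enumeration hec.to_comp (by
    intro a a' p p' s s' h h' hpp
    cases h
    cases h'
    obtain ⟨hl, hss⟩ := replicate_false_append_prefix hpp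
    rw [hss.eq_of_length hl]
    exact ⟨rfl, rfl⟩)
  refine ⟨c + 1, fun n => ?_⟩
  obtain ⟨q, hq, hql⟩ := hc (natToStr n) _ _ rfl
  have := natComplexity_le hq
  simp only [List.length_append, List.length_replicate, List.length_cons] at hql
  omega

/-- The `n`-th string has length about `log₂ n`, so `H(n)` is at most logarithmic. -/
theorem IsOptimal.eventually_natComplexity_add_le {U : BinStr →. BinStr} (hU : IsOptimal U)
    (d : ℕ) : ∀ᶠ n : ℕ in Filter.atTop, natComplexity U n + d ≤ n := by
  obtain ⟨c, hc⟩ := hU.natComplexity_le_two_mul_length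
  have hlin : ∀ l : ℕ, 4 * l ≤ 2 ^ l + 4 := by
    intro l
    induction l with
    | zero => simp
    | succ l ih =>
      rcases Nat.lt_or_ge l 2 with h | h
      · interval_cases l <;> norm_num
      · have : 2 ^ 2 ≤ 2 ^ l := Nat.pow_le_pow_right (by norm_num) h
        rw [pow_succ]
        omega
  filter_upwards [Filter.eventually_ge_atTop (2 * (c + d) + 5)] with n hn
  have h1 := hc n
  have h2 := two_pow_length_le (natToStr n)
  rw [strToNat_natToStr] at h2
  have h3 := hlin (natToStr n).length
  omega

/-! ### The upper bound -/

/-- The pair `y` consists of a program and an output of length `n` that is longer than it. -/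
def IsShort (o : Option (BinStr × BinStr)) (n : ℕ) : Prop :=
  ∃ y ∈ o, y.1.length < n ∧ y.2.length = n

instance (o : Option (BinStr × BinStr)) (n : ℕ) : Decidable (IsShort o n) :=
  inferInstanceAs (Decidable (∃ y ∈ o, y.1.length < n ∧ y.2.length = n))

theorem primrec_isShort : Primrec fun a : Option (BinStr × BinStr) × ℕ =>
    if IsShort a.1 a.2 then 1 else 0 := by
  have h : Primrec₂ fun (a : Option (BinStr × BinStr) × ℕ) (y : BinStr × BinStr) =>
      if y.1.length < a.2 ∧ y.2.length = a.2 then 1 else 0 :=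
    Primrec.ite (PrimrecPred.and
      (Primrec.nat_lt.comp (Primrec.list_length.comp (Primrec.fst.comp Primrec.snd))
        (Primrec.snd.comp Primrec.fst))
      (Primrec.eq.comp (Primrec.list_length.comp (Primrec.snd.comp Primrec.snd))
        (Primrec.snd.comp Primrec.fst))) (Primrec.const 1) (Primrec.const 0)
  refine (Primrec.option_casesOn Primrec.fst (Primrec.const 0) h).of_eq ?_
  rintro ⟨_ | y, n⟩ <;> simp [IsShort]

/-- The number of programs among the first `k` entries of an enumeration that are shorter than
their output, which has length `n`. -/
def shortCount (e : ℕ → Option (BinStr × BinStr)) (n k : ℕ) : ℕ :=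
  Nat.count (fun i => IsShort (e i) n) k

theorem computable_shortCount {e : ℕ → Option (BinStr × BinStr)} (he : Computable e) :
    Computable₂ (shortCount e) := by
  have hstep : Computable₂ fun (a : ℕ × ℕ) (x : ℕ × ℕ) =>
      x.2 + if IsShort (e x.1) a.1 then 1 else 0 :=
    Primrec.nat_add.to_comp.comp (Computable.snd.comp Computable.snd)
      (primrec_isShort.to_comp.comp ((he.comp (Computable.fst.comp Computable.snd)).pair
        (Computable.fst.comp Computable.fst)))
  refine (Computable.nat_rec Computable.snd (Computable.const 0) hstep).of_eq ?_
  rintro ⟨n, k⟩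
  induction k with
  | zero => simp [shortCount]
  | succ k ih => simpa [shortCount, Nat.count_succ] using ih

/-- The request for a description of the `n`-th string `s` of length `n - j + 1`, made when the
count `shortCount e n` passes `2 ^ j`. -/
def countRequest (b : (ℕ × ℕ) × (ℕ × BinStr)) : Option (ℕ × BinStr) :=
  if b.1.1 < 2 ^ b.2.1 ∧ 2 ^ b.2.1 ≤ b.1.2 ∧ b.2.1 ≤ strToNat b.2.2 then
    some (strToNat b.2.2 - b.2.1 + 1, b.2.2)
  else none

theorem primrec_countRequest : Primrec countRequest := by
  have hj : Primrec fun b : (ℕ × ℕ) × (ℕ × BinStr) => b.2.1 := Primrec.fst.comp Primrec.snd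
  have hs : Primrec fun b : (ℕ × ℕ) × (ℕ × BinStr) => b.2.2 := Primrec.snd.comp Primrec.snd
  have h2j := primrec_two_pow.comp hj
  have hn := primrec_strToNat.comp hs
  exact Primrec.ite ((Primrec.nat_lt.comp (Primrec.fst.comp Primrec.fst) h2j).and
    ((Primrec.nat_le.comp h2j (Primrec.snd.comp Primrec.fst)).and (Primrec.nat_le.comp hj hn)))
    (Primrec.option_some.comp ((Primrec.succ.comp (Primrec.nat_sub.comp hn hj)).pair hs))
    (Primrec.const none)

/-- The requests made along an enumeration. -/
def shortRequest (e : ℕ → Option (BinStr × BinStr)) (a : ℕ × (ℕ × BinStr)) :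
    Option (ℕ × BinStr) :=
  countRequest ((shortCount e (strToNat a.2.2) a.1, shortCount e (strToNat a.2.2) (a.1 + 1)), a.2)

theorem computable_shortRequest {e : ℕ → Option (BinStr × BinStr)} (he : Computable e) :
    Computable (shortRequest e) := by
  have hn : Computable fun a : ℕ × (ℕ × BinStr) => strToNat a.2.2 :=
    primrec_strToNat.to_comp.comp (Computable.snd.comp Computable.snd)
  exact primrec_countRequest.to_comp.comp
    ((((computable_shortCount he).comp hn Computable.fst).pair
      ((computable_shortCount he).comp hn (Computable.succ.comp Computable.fst))).pair
        Computable.snd)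

/-- Each counted program has one output, hence counts for one `n`, and being shorter than `n` it
contributes `2^(-n) ≤ 2^(-|p|)`; Kraft's inequality concludes. The strings `s` in `S` stand for the
numbers `n`. -/
theorem sum_shortCount_le {e : ℕ → Option (BinStr × BinStr)} {T : ℕ} (S : Finset BinStr)
    (hinj : ∀ k k' p s s', e k = some (p, s) → e k' = some (p, s') → k = k')
    (hpf : IsPrefixFree {p | ∃ k s, e k = some (p, s)}) :
    ∑ s ∈ S, (shortCount e (strToNat s) T : ℝ) * (1 / 2) ^ strToNat s ≤ 1 := by
  let W : Option (BinStr × BinStr) → ℝ := fun o => o.elim 0 fun y => (1 / 2) ^ y.1.length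
  calc ∑ s ∈ S, (shortCount e (strToNat s) T : ℝ) * (1 / 2) ^ strToNat s
      = ∑ s ∈ S, ∑ i ∈ Finset.range T,
          if IsShort (e i) (strToNat s) then (1 / 2 : ℝ) ^ strToNat s else 0 := by
        refine Finset.sum_congr rfl fun s _ => ?_
        rw [shortCount, Nat.count_eq_card_filter_range, ← Finset.sum_filter, Finset.sum_const,
          nsmul_eq_mul]
    _ = ∑ i ∈ Finset.range T, ∑ s ∈ S,
          if IsShort (e i) (strToNat s) then (1 / 2 : ℝ) ^ strToNat s else 0 :=
        Finset.sum_comm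
    _ ≤ ∑ i ∈ Finset.range T, W (e i) := by
        refine Finset.sum_le_sum fun i _ => ?_
        cases hi : e i with
        | none => simp [IsShort, W]
        | some y =>
          calc _ ≤ ∑ s ∈ S, if s = natToStr y.2.length then (1 / 2 : ℝ) ^ y.1.length else 0 := by
                refine Finset.sum_le_sum fun s _ => ?_
                by_cases hs : IsShort (some y) (strToNat s)
                · obtain ⟨y', hy', h1, h2⟩ := hs
                  cases hy'
                  have hs' : s = natToStr y.2.length := by rw [h2, natToStr_strToNat]
                  rw [if_pos hs']
                  split_ifs
                  · exact pow_le_pow_of_le_one (by norm_num) (by norm_num) h1.le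
                  · positivity
                · rw [if_neg hs]
                  split_ifs <;> positivity
            _ ≤ (1 / 2 : ℝ) ^ y.1.length := by
                rw [Finset.sum_ite_eq']
                split_ifs
                · exact le_rfl
                · positivity
            _ = W (some y) := rfl
    _ = ∑ i ∈ (Finset.range T).filter fun i => (e i).isSome, W (e i) := by
        rw [Finset.sum_filter]
        refine Finset.sum_congr rfl fun i _ => ?_
        cases e i <;> simp [W]
    _ = ∑ p ∈ ((Finset.range T).filter fun i => (e i).isSome).image
          fun i => ((e i).map Prod.fst).getD [], (1 / 2 : ℝ) ^ p.length := by
        rw [Finset.sum_image]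
        · refine Finset.sum_congr rfl fun i hi => ?_
          obtain ⟨y, hy⟩ := Option.isSome_iff_exists.1 (Finset.mem_filter.1 hi).2
          simp [W, hy]
        · intro i hi i' hi' h
          obtain ⟨⟨p, s⟩, hy⟩ := Option.isSome_iff_exists.1 (Finset.mem_filter.1 hi).2
          obtain ⟨⟨p', s'⟩, hy'⟩ := Option.isSome_iff_exists.1 (Finset.mem_filter.1 hi').2
          simp only [hy, hy', Option.map_some, Option.getD_some] at h
          subst h
          exact hinj _ _ _ _ _ hy hy'
    _ ≤ 1 := by
        refine IsPrefixFree.kraft fun p hp q hq => hpf p ?_ q ?_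
        all_goals
          simp only [Finset.coe_image, Set.mem_image, Finset.mem_coe, Finset.mem_filter] at hp hq
        · obtain ⟨i, ⟨-, hi⟩, rfl⟩ := hp
          obtain ⟨⟨p, s⟩, hy⟩ := Option.isSome_iff_exists.1 hi
          exact ⟨i, s, by simp [hy]⟩
        · obtain ⟨i, ⟨-, hi⟩, rfl⟩ := hq
          obtain ⟨⟨p, s⟩, hy⟩ := Option.isSome_iff_exists.1 hi
          exact ⟨i, s, by simp [hy]⟩

theorem sum_two_pow_le {J : Finset ℕ} {N : ℕ} (hJ : ∀ j ∈ J, 2 ^ j ≤ N) :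
    ∑ j ∈ J, 2 ^ j ≤ 2 * N := by
  rcases J.eq_empty_or_nonempty with rfl | ⟨j₀, hj₀⟩
  · simp
  have hN : N ≠ 0 := by
    have := hJ j₀ hj₀
    have : 0 < 2 ^ j₀ := by positivity
    omega
  have h := Nat.geomSum_lt (m := 2) (n := Nat.log 2 N + 1) (s := J) le_rfl fun j hj =>
    Nat.lt_succ_of_le (Nat.le_log_of_pow_le (by norm_num) (hJ j hj))
  have h2 := Nat.pow_log_le_self 2 hN
  rw [pow_succ] at h
  omega

/-- For fixed `n`, the powers `2^j` passed by the count `N` sum to at most `2N`. The extra bit in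
the length `n - j + 1` absorbs the factor `2`, leaving `N 2^(-n)`. -/
theorem sum_shortRequest_le {e : ℕ → Option (BinStr × BinStr)}
    (hinj : ∀ k k' p s s', e k = some (p, s) → e k' = some (p, s') → k = k')
    (hpf : IsPrefixFree {p | ∃ k s, e k = some (p, s)}) (F : Finset (ℕ × (ℕ × BinStr))) :
    ∑ a ∈ F, requestWeight (shortRequest e a) ≤ 1 := by
  let P : ℕ × (ℕ × BinStr) → Prop := fun a =>
    shortCount e (strToNat a.2.2) a.1 < 2 ^ a.2.1 ∧
      2 ^ a.2.1 ≤ shortCount e (strToNat a.2.2) (a.1 + 1) ∧ a.2.1 ≤ strToNat a.2.2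
  have hmono : ∀ n, Monotone (shortCount e n) := fun n => Nat.count_monotone _
  obtain ⟨T, hT⟩ : ∃ T, ∀ a ∈ F, a.1 + 1 ≤ T :=
    ⟨F.sup fun a => a.1 + 1, fun a ha => Finset.le_sup (f := fun a => a.1 + 1) ha⟩
  have hweight : ∀ a, requestWeight (shortRequest e a) =
      if P a then (2 : ℝ) ^ a.2.1 * (1 / 2) ^ strToNat a.2.2 / 2 else 0 := by
    intro a
    by_cases h : P a
    · have h' : shortRequest e a = some (strToNat a.2.2 - a.2.1 + 1, a.2.2) := if_pos h
      rw [if_pos h, h', requestWeight, Option.elim_some]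
      obtain ⟨m, hm⟩ := Nat.exists_eq_add_of_le h.2.2
      rw [hm, Nat.add_sub_cancel_left, pow_succ, pow_add, ← mul_assoc, ← mul_pow]
      norm_num
      ring
    · have h' : shortRequest e a = none := if_neg h
      rw [if_neg h, h', requestWeight, Option.elim_none]
  calc ∑ a ∈ F, requestWeight (shortRequest e a)
      = ∑ a ∈ F.filter P, (2 : ℝ) ^ a.2.1 * (1 / 2) ^ strToNat a.2.2 / 2 := by
        rw [Finset.sum_filter]
        exact Finset.sum_congr rfl fun a _ => hweight a
    _ = ∑ s ∈ F.image fun a => a.2.2, ∑ a ∈ (F.filter P).filter fun a => a.2.2 = s,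
          (2 : ℝ) ^ a.2.1 * (1 / 2) ^ strToNat a.2.2 / 2 :=
        (Finset.sum_fiberwise_of_maps_to (fun a ha =>
          Finset.mem_image_of_mem _ (Finset.mem_filter.1 ha).1) _).symm
    _ ≤ ∑ s ∈ F.image fun a => a.2.2,
          (shortCount e (strToNat s) T : ℝ) * (1 / 2) ^ strToNat s := by
        refine Finset.sum_le_sum fun s _ => ?_
        set G := (F.filter P).filter fun a => a.2.2 = s with hG
        have hmem : ∀ a ∈ G, a ∈ F ∧ P a ∧ a.2.2 = s := fun a ha =>
          ⟨(Finset.mem_filter.1 (Finset.mem_filter.1 ha).1).1,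
            (Finset.mem_filter.1 (Finset.mem_filter.1 ha).1).2, (Finset.mem_filter.1 ha).2⟩
        -- The count is monotone, so it passes `2^j` at a single time: `j` determines the request.
        have hGinj : Set.InjOn (fun a : ℕ × (ℕ × BinStr) => a.2.1) G := by
          rintro ⟨k, j, s₁⟩ ha ⟨k', j', s₁'⟩ ha' hjj
          obtain ⟨-, ⟨h1, h2, -⟩, hs⟩ := hmem _ ha
          obtain ⟨-, ⟨h1', h2', -⟩, hs'⟩ := hmem _ ha'
          dsimp only at *
          subst hjj hs hs'
          have hkk : k = k' := by
            by_contra hne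
            rcases Nat.lt_or_gt_of_ne hne with hlt | hlt
            · have := hmono (strToNat s₁') (show k + 1 ≤ k' from hlt)
              omega
            · have := hmono (strToNat s₁') (show k' + 1 ≤ k from hlt)
              omega
          rw [hkk]
        have hsum : ∑ j ∈ G.image fun a => a.2.1, 2 ^ j ≤ 2 * shortCount e (strToNat s) T := by
          refine sum_two_pow_le fun j hj => ?_
          obtain ⟨a, ha, rfl⟩ := Finset.mem_image.1 hj
          obtain ⟨haF, ⟨-, h2, -⟩, rfl⟩ := hmem a ha
          exact h2.trans (hmono _ (hT a haF))
        rw [Finset.sum_image hGinj] at hsum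
        have hsum' : ∑ a ∈ G, (2 : ℝ) ^ a.2.1 ≤ 2 * shortCount e (strToNat s) T := by
          exact_mod_cast hsum
        calc ∑ a ∈ G, (2 : ℝ) ^ a.2.1 * (1 / 2) ^ strToNat a.2.2 / 2
            = (∑ a ∈ G, (2 : ℝ) ^ a.2.1) * ((1 / 2) ^ strToNat s / 2) := by
              rw [Finset.sum_mul]
              refine Finset.sum_congr rfl fun a ha => ?_
              rw [(hmem a ha).2.2, mul_div_assoc]
          _ ≤ 2 * shortCount e (strToNat s) T * ((1 / 2) ^ strToNat s / 2) :=
              mul_le_mul_of_nonneg_right hsum' (by positivity)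
          _ = shortCount e (strToNat s) T * (1 / 2) ^ strToNat s := by ring
    _ ≤ 1 := sum_shortCount_le _ hinj hpf

/-- Each of the finitely many compressible strings has a short program, and all of these have been
enumerated by some finite time. -/
theorem exists_ncard_compressible_le_shortCount {V : BinStr →. BinStr}
    {e : ℕ → Option (BinStr × BinStr)} (he : ∀ p s, s ∈ V p ↔ ∃ k, e k = some (p, s)) (n : ℕ) :
    ∃ T, (compressible V n).ncard ≤ shortCount e n T := by
  have h : ∀ s, ∃ k, s ∈ compressible V n →
      ∃ p, e k = some (p, s) ∧ p.length < n ∧ s.length = n := fun s => by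
    by_cases hs : s ∈ compressible V n
    · obtain ⟨hl, p, hp, hpl⟩ := mem_compressible.1 hs
      obtain ⟨k, hk⟩ := (he p s).1 hp
      exact ⟨k, fun _ => ⟨p, hk, hpl, hl⟩⟩
    · exact ⟨0, fun h => absurd h hs⟩
  choose f hf using h
  obtain ⟨T, hT⟩ := ((finite_compressible V n).image f).bddAbove
  refine ⟨T + 1, ?_⟩
  rw [shortCount, Nat.count_eq_card_filter_range, ← Set.ncard_coe_finset]
  refine Set.ncard_le_ncard_of_injOn f ?_ ?_ (Finset.finite_toSet _)
  · intro s hs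
    obtain ⟨p, hk, hpl, hl⟩ := hf s hs
    simp only [Finset.mem_coe, Finset.mem_filter, Finset.mem_range]
    exact ⟨Nat.lt_succ_of_le (hT (Set.mem_image_of_mem f hs)), (p, s), hk, hpl, hl⟩
  · intro s hs s' hs' hss
    obtain ⟨p, hk, -⟩ := hf s hs
    obtain ⟨p', hk', -⟩ := hf s' hs'
    rw [hss, hk'] at hk
    cases hk
    rfl

theorem exists_natComplexity_add_le {U V : BinStr →. BinStr} (hU : IsOptimal U)
    (hV : IsPrefixFreeMachine V) : ∃ d : ℕ, ∀ n j, 2 ^ j ≤ (compressible V n).ncard →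
      natComplexity U n + j ≤ n + d := by
  obtain ⟨e, hec, he, hinj⟩ := exists_graph_enumeration hV.1
  have hpf : IsPrefixFree {p | ∃ k s, e k = some (p, s)} := by
    rintro p ⟨k, s, hk⟩ p' ⟨k', s', hk'⟩ h
    exact hV.2 p (Part.dom_iff_mem.2 ⟨s, (he _ _).2 ⟨k, hk⟩⟩) p'
      (Part.dom_iff_mem.2 ⟨s', (he _ _).2 ⟨k', hk'⟩⟩) h
  obtain ⟨d, hd⟩ := hU.kraft_chaitin (computable_shortRequest hec)
    (sum_shortRequest_le hinj hpf)
  refine ⟨d + 1, fun n j hj => ?_⟩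
  -- Requests are made only for `j ≤ n`, where `n - j` does not truncate.
  have hjn : j ≤ n := by
    have h := Set.ncard_le_ncard (compressible_subset V n) (finite_stringsOfLength n)
    rw [ncard_stringsOfLength] at h
    exact (Nat.pow_le_pow_iff_right (by norm_num)).1 (hj.trans h)
  obtain ⟨T, hT⟩ := exists_ncard_compressible_le_shortCount he n
  -- The least such time is positive, since the count starts at `0`; the step just before it
  -- triggers the request.
  have hex : ∃ k, 2 ^ j ≤ shortCount e n k := ⟨T, hj.trans hT⟩
  have hpos : Nat.find hex ≠ 0 := fun h0 => by
    have h := Nat.find_spec hex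
    rw [h0, shortCount, Nat.count_zero] at h
    have : 0 < 2 ^ j := by positivity
    omega
  obtain ⟨k, hk⟩ := Nat.exists_eq_succ_of_ne_zero hpos
  have h1 : 2 ^ j ≤ shortCount e n (k + 1) := by
    have h := Nat.find_spec hex
    rwa [hk] at h
  have h2 : shortCount e n k < 2 ^ j := not_le.1 (Nat.find_min hex (by omega))
  obtain ⟨q, hq, hql⟩ := hd (k, j, natToStr n) (n - j + 1) (natToStr n) (by
    simp only [shortRequest, countRequest, strToNat_natToStr]
    exact if_pos ⟨h2, h1, hjn⟩)
  have := natComplexity_le hq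
  omega

end AIT

/-! ### Assembly of the two bounds -/

theorem mainTheorem6 (U V : AIT.BinStr →. AIT.BinStr)
    (hU : AIT.IsOptimal U) (hV : AIT.IsOptimal V) :
    (∀ n : ℕ, AIT.compressible V n ⊂ AIT.stringsOfLength n) ∧
    ∃ d : ℕ,
      (∀ n : ℕ, ((AIT.compressible V n).ncard : ℝ) ≤
        (2 : ℝ) ^ ((n : ℤ) - (AIT.natComplexity U n : ℤ) + (d : ℤ))) ∧
      (∀ᶠ n : ℕ in Filter.atTop,
        (2 : ℝ) ^ ((n : ℤ) - (AIT.natComplexity U n : ℤ) - (d : ℤ)) ≤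
          ((AIT.compressible V n).ncard : ℝ)) := by
  refine ⟨AIT.compressible_ssubset V, ?_⟩
  obtain ⟨d₁, h₁⟩ := AIT.exists_natComplexity_add_le hU hV.1
  obtain ⟨d₂, h₂⟩ := AIT.exists_two_pow_le_ncard_compressible hU hV
  refine ⟨d₁ + 1 + d₂, fun n => ?_, ?_⟩
  · rcases Nat.eq_zero_or_pos (AIT.compressible V n).ncard with h0 | hpos
    · rw [h0, Nat.cast_zero]
      positivity
    · have hj := h₁ n _ (Nat.pow_log_le_self 2 hpos.ne')
      have hlt := Nat.lt_pow_succ_log_self (b := 2) (by norm_num) (AIT.compressible V n).ncard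
      calc ((AIT.compressible V n).ncard : ℝ)
          ≤ (2 : ℝ) ^ (Nat.log 2 (AIT.compressible V n).ncard + 1) := by exact_mod_cast hlt.le
        _ = (2 : ℝ) ^ ((Nat.log 2 (AIT.compressible V n).ncard + 1 : ℕ) : ℤ) :=
            (zpow_natCast _ _).symm
        _ ≤ _ := zpow_le_zpow_right₀ (by norm_num) (by push_cast; omega)
  · filter_upwards [hU.eventually_natComplexity_add_le d₂] with n hn
    calc (2 : ℝ) ^ ((n : ℤ) - (AIT.natComplexity U n : ℤ) - ((d₁ + 1 + d₂ : ℕ) : ℤ))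
        ≤ (2 : ℝ) ^ ((n - AIT.natComplexity U n - d₂ : ℕ) : ℤ) :=
          zpow_le_zpow_right₀ (by norm_num) (by push_cast; omega)
      _ = (2 : ℝ) ^ (n - AIT.natComplexity U n - d₂) := zpow_natCast _ _
      _ ≤ _ := by exact_mod_cast h₂ n hn
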